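/- Let $G=(V,E)$ be a finite, simple, connected, undirected graph with at least two nodes and $m=|E|$ edges, and let $d(v)$ denote the degree of $v$ in $G$. Consider the simple random walk on $G$, which at each step moves to a uniformly random neighbor of its current node. For $i,j\in V$ let $H(i,j)$ be the expected number of steps until the walk started at $i$ first visits $j$ (so $H(j,j)=0$), and let $\pi_j=d(j)/(2m)$ be the stationary distribution. The Kemeny constant of $G$ is $$\kappa(G)=\sum_{j\in V}\pi_j\,H(s,j),$$ where $s\in V$ is an arbitrary starting node; the value does not depend on $s$. Let $\Gamma$ be the set of spanning trees of $G$. A 2-forest of $G$ is an acyclic spanning subgraph of $G$ with exactly two connected components (a component may be a single node); it is written $T_1\cup T_2$, where $T_1,T_2$ are the node sets of its two trees. For nodes $r\neq u$ let $\mathbb F_{r\mid u}$ be the set of 2-forests of $G$ in which $r$ and $u$ belong to different trees. For $S\subseteq V$ put $\mathrm{vol}(S)=\sum_{v\in S}d(v)$, with degrees taken in $G$. Then for every node $r\in V$ and every starting node $s\in V$, $\sum_{j}\pi_j H(s,j)$ is finite, and $$\kappa(G)=\sum_{j\in V}\pi_j\,H(s,j)=\frac{1}{2m|\Gamma|}\sum_{u\in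 V,\,u\neq r}d(u)\sum_{\substack{T_1\cup T_2\in\mathbb F_{r\mid u}\\ r\in T_1}}\mathrm{vol}(T_1).$$ -/

import Mathlib

open scoped ENNReal

noncomputable section

namespace KemenyForest

variable {V : Type*} [Fintype V] [DecidableEq V]

/-! ### Random walk, hitting times, and the Kemeny constant -/

/-- One step of the simple random walk from `v`: a uniformly random neighbor of `v`.
(At an isolated vertex the walk stays where it is.) -/
def step (G : SimpleGraph V) [DecidableRel G.Adj] (v : V) : PMF V :=
  if h : (G.neighborFinset v).Nonempty then PMF.uniformOfFinset (G.neighborFinset v) h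
  else PMF.pure v

/-- The transition kernel of the walk at time `n`: given the trajectory `x₀, …, xₙ`, the next
position is drawn from `step G xₙ`. Here `V` carries the discrete σ-algebra. -/
def walkKernel (G : SimpleGraph V) [DecidableRel G.Adj] [MeasurableSpace V]
    [DiscreteMeasurableSpace V] (n : ℕ) :
    ProbabilityTheory.Kernel ((_ : Finset.Iic n) → V) V :=
  ProbabilityTheory.Kernel.comap
    (ProbabilityTheory.Kernel.ofFunOfCountable fun v => (step G v).toMeasure)
    (fun x => x ⟨n, Finset.mem_Iic.2 le_rfl⟩) (measurable_pi_apply _)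

instance (G : SimpleGraph V) [DecidableRel G.Adj] [MeasurableSpace V]
    [DiscreteMeasurableSpace V] (n : ℕ) :
    ProbabilityTheory.IsMarkovKernel (walkKernel G n) where
  isProbabilityMeasure x := by
    change MeasureTheory.IsProbabilityMeasure
      (step G (x ⟨n, Finset.mem_Iic.2 le_rfl⟩)).toMeasure
    infer_instance

/-- The law, on the space of infinite trajectories, of the random walk on `G` started at `i`. -/
def walkLaw (G : SimpleGraph V) [DecidableRel G.Adj] [MeasurableSpace V]
    [DiscreteMeasurableSpace V] (i : V) : MeasureTheory.Measure (ℕ → V) :=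
  ProbabilityTheory.Kernel.traj (X := fun _ => V) (fun n => walkKernel G n) 0 (fun _ => i)

/-- The first time the trajectory `x` visits `j` (`∞` if it never does). -/
def firstVisit (j : V) (x : ℕ → V) : ℝ≥0∞ :=
  ⨅ (n : ℕ) (_ : x n = j), (n : ℝ≥0∞)

/-- The hitting time `H(i, j)`: the expected number of steps until the random walk on `G`
started at `i` first visits `j`. -/
def hittingTime (G : SimpleGraph V) [DecidableRel G.Adj] (i j : V) : ℝ≥0∞ :=
  letI : MeasurableSpace V := ⊤
  haveI : DiscreteMeasurableSpace V := ⟨fun _ => trivial⟩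
  ∫⁻ x, firstVisit j x ∂(walkLaw G i)

/-- The stationary distribution `π_j = d(j) / 2m` of the random walk on `G`. -/
def stationary (G : SimpleGraph V) [DecidableRel G.Adj] (j : V) : ℝ≥0∞ :=
  (G.degree j : ℝ≥0∞) / (2 * (G.edgeFinset.card : ℝ≥0∞))

/-- The Kemeny constant `∑_j π_j H(i, j)`, computed from the starting node `i`. -/
def kemenyConstant (G : SimpleGraph V) [DecidableRel G.Adj] (i : V) : ℝ≥0∞ :=
  ∑ j : V, stationary G j * hittingTime G i j

/-! ### Spanning trees and 2-forests -/

/-- The set `Γ` of spanning trees of `G`, as graphs on the whole vertex set. -/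
def spanningTrees (G : SimpleGraph V) : Finset (SimpleGraph V) :=
  open Classical in {T : SimpleGraph V | T ≤ G ∧ T.IsTree}

/-- The 2-forests of `G`: spanning acyclic subgraphs with exactly two components. -/
def twoForests (G : SimpleGraph V) : Finset (SimpleGraph V) :=
  open Classical in
  {F : SimpleGraph V | F ≤ G ∧ F.IsAcyclic ∧ Nat.card F.ConnectedComponent = 2}

/-- The set `𝔽_{r|u}` of 2-forests in which `r` and `u` belong to different trees. -/
def separatingForests (G : SimpleGraph V) (r u : V) : Finset (SimpleGraph V) :=
  open Classical in {F ∈ twoForests G | ¬ F.Reachable r u}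

/-- The node set of the tree of the forest `F` that contains `r`. -/
def treeOf (F : SimpleGraph V) (r : V) : Finset V :=
  open Classical in {v : V | F.Reachable r v}

/-- The volume of a set of nodes: the sum of their degrees in `G`. -/
def vol (G : SimpleGraph V) [DecidableRel G.Adj] (S : Finset V) : ℕ :=
  ∑ v ∈ S, G.degree v

end KemenyForest

end

open scoped ENNReal

noncomputable section

namespace KemenyForest

open SimpleGraph Finset

/-! ### Spanning trees and 2-forests: cutting and adding one edge -/

section Combinatorics

variable {V : Type*}

/-! For fixed `j`, let `N i` be the sum, over 2-forests separating `i` from `j`, of the volume of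
the tree of `i`. The core is `hittingTime_eq_forest`: H(i,j) = N i / |Γ|. Both sides vanish at `j`
and have Laplacian d(i) at each `i ≠ j`, which determines them on a connected graph
(`eq_of_sum_sub_eq`).

For H this is first-step analysis. For `N` (`sum_forestWeight_sub`), only forests separating `i`
from `k` contribute to N i - N k, and these are the spanning trees through `ik` with that edge
removed. Exchanging sums leaves, for each spanning tree, a sum over its edges at `i`; each node
other than `i` lies beyond exactly one of them, so everything cancels except the weight of `i`.

Taking `s` as root gives the formula at once. Any root gives the same value, since the double sum
equals Σ_F vol(T₁) vol(T₂). -/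

/-- In a tree, every node other than `i` lies beyond exactly one of the edges at `i`. -/
lemma existsUnique_adj_reachable_deleteEdges {T : SimpleGraph V} (hT : T.IsTree) {i v : V}
    (hv : v ≠ i) :
    ∃! k, T.Adj i k ∧ (T.deleteEdges {s(i, k)}).Reachable k v := by
  classical
  obtain ⟨p, hp, hu⟩ := hT.existsUnique_path i v
  cases p with
  | nil => exact absurd rfl hv
  | @cons _ k _ h q =>
    rw [Walk.cons_isPath_iff] at hp
    refine ⟨k, ⟨h, reachable_deleteEdges_iff_exists_walk.2 ⟨q, fun he => hp.2 ?_⟩⟩, ?_⟩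
    · exact q.fst_mem_support_of_mem_edges he
    · rintro k' ⟨h', hr⟩
      obtain ⟨q', hq'⟩ := hr.exists_isPath
      -- A visit to `i` would join `k'` to `i` without the bridge `ik'`. So prepending `ik'` gives a
      -- path, and uniqueness forces `k' = k`.
      have hi : i ∉ q'.support := fun hi => by
        have hb := isAcyclic_iff_forall_adj_isBridge.1 hT.isAcyclic h'
        rw [isBridge_iff] at hb
        exact hb ⟨(q'.takeUntil i hi).reverse⟩
      have hle : T.deleteEdges {s(i, k')} ≤ T := deleteEdges_le _
      have := hu (Walk.cons h' (q'.mapLe hle))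
        ((Walk.cons_isPath_iff ..).2 ⟨hq'.mapLe hle, by simpa using hi⟩)
      have := congrArg Walk.snd this
      simpa using this

lemma reachable_or_of_card_eq_two {F : SimpleGraph V} (hF : Nat.card F.ConnectedComponent = 2)
    {i k : V} (hik : ¬ F.Reachable i k) (x : V) : F.Reachable i x ∨ F.Reachable k x := by
  obtain ⟨a, b, -, hab⟩ := Nat.card_eq_two_iff.1 hF
  have key : ∀ y, F.connectedComponentMk y = a ∨ F.connectedComponentMk y = b := fun y => by
    have : F.connectedComponentMk y ∈ ({a, b} : Set _) := hab ▸ Set.mem_univ _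
    simpa using this
  rw [← ConnectedComponent.eq] at hik ⊢
  rw [← ConnectedComponent.eq]
  grind

lemma card_connectedComponent_eq_two {F : SimpleGraph V} {i k : V} (hik : ¬ F.Reachable i k)
    (h : ∀ x, F.Reachable i x ∨ F.Reachable k x) : Nat.card F.ConnectedComponent = 2 := by
  refine Nat.card_eq_two_iff.2 ⟨F.connectedComponentMk i, F.connectedComponentMk k,
    fun he => hik (ConnectedComponent.eq.1 he), Set.eq_univ_of_forall fun c => ?_⟩
  induction c using ConnectedComponent.ind with | _ x
  rcases h x with h | h
  · exact Or.inl (ConnectedComponent.eq.2 h.symm)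
  · exact Or.inr (ConnectedComponent.eq.2 h.symm)

lemma reachable_iff_not_reachable {F : SimpleGraph V} (hF : Nat.card F.ConnectedComponent = 2)
    {i k : V} (hik : ¬ F.Reachable i k) (x : V) : F.Reachable i x ↔ ¬ F.Reachable k x :=
  ⟨fun h h' => hik (h.trans h'.symm), (reachable_or_of_card_eq_two hF hik x).resolve_right⟩

lemma isTree_sup_edge {F : SimpleGraph V} (hF : F.IsAcyclic)
    (hc : Nat.card F.ConnectedComponent = 2) {i k : V} (hik : ¬ F.Reachable i k) :
    (F ⊔ edge i k).IsTree := by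
  have hne : i ≠ k := fun h => hik (h ▸ Reachable.refl _)
  have hadj : (F ⊔ edge i k).Adj i k := Or.inr (by simp [edge_adj, hne])
  have hle : F ≤ F ⊔ edge i k := le_sup_left
  have hi : ∀ x, (F ⊔ edge i k).Reachable i x := fun x => by
    rcases reachable_or_of_card_eq_two hc hik x with h | h
    · exact h.mono hle
    · exact hadj.reachable.trans (h.mono hle)
  have : Nonempty V := ⟨i⟩
  exact ⟨⟨fun x y => (hi x).symm.trans (hi y)⟩, hF.sup_edge_of_not_reachable hik⟩

lemma not_reachable_deleteEdges {T : SimpleGraph V} (hT : T.IsTree) {i k : V} (h : T.Adj i k) :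
    ¬ (T.deleteEdges {s(i, k)}).Reachable i k := by
  have hb := isAcyclic_iff_forall_adj_isBridge.1 hT.isAcyclic h
  rwa [isBridge_iff] at hb

lemma sup_edge_deleteEdges {T : SimpleGraph V} {i k : V} (h : T.Adj i k) :
    T.deleteEdges {s(i, k)} ⊔ edge i k = T := by
  ext a b
  have := h.ne
  have := h.symm
  simp only [sup_adj, deleteEdges_adj, edge_adj, Set.mem_singleton_iff, Sym2.eq_iff]
  grind

lemma deleteEdges_sup_edge {F : SimpleGraph V} {i k : V} (h : ¬ F.Adj i k) :
    (F ⊔ edge i k).deleteEdges {s(i, k)} = F := by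
  ext a b
  have h' : ¬ F.Adj k i := fun h' => h h'.symm
  simp only [sup_adj, deleteEdges_adj, edge_adj, Set.mem_singleton_iff, Sym2.eq_iff]
  grind

/-- A path from `i` never returns to `i`, so it can use `ik` only as its first edge. -/
lemma reachable_or_deleteEdges {T : SimpleGraph V} (hT : T.IsTree) (i k : V)
    (x : V) : (T.deleteEdges {s(i, k)}).Reachable i x ∨
      (T.deleteEdges {s(i, k)}).Reachable k x := by
  by_cases hx : x = i
  · exact Or.inl (hx ▸ Reachable.refl _)
  classical
  obtain ⟨p, hp, -⟩ := hT.existsUnique_path i x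
  cases p with
  | nil => exact absurd rfl hx
  | @cons _ k' _ h' q =>
    rw [Walk.cons_isPath_iff] at hp
    have hq : (T.deleteEdges {s(i, k)}).Reachable k' x :=
      reachable_deleteEdges_iff_exists_walk.2
        ⟨q, fun he => hp.2 (q.fst_mem_support_of_mem_edges he)⟩
    by_cases hk : k' = k
    · exact Or.inr (hk ▸ hq)
    · refine Or.inl (Reachable.trans (Adj.reachable ?_) hq)
      rw [deleteEdges_adj]
      refine ⟨h', fun he => ?_⟩
      simp only [Set.mem_singleton_iff, Sym2.eq_iff] at he
      grind

variable [Fintype V] [DecidableEq V]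

lemma mem_spanningTrees {G T : SimpleGraph V} : T ∈ spanningTrees G ↔ T ≤ G ∧ T.IsTree := by
  simp [spanningTrees]

lemma mem_twoForests {G F : SimpleGraph V} :
    F ∈ twoForests G ↔ F ≤ G ∧ F.IsAcyclic ∧ Nat.card F.ConnectedComponent = 2 := by
  simp [twoForests]

open Classical in
/-- Adding an edge `ik` of `G` to a 2-forest separating `i` from `k` gives a spanning tree
through `ik`, and every such tree arises exactly once. -/
lemma sum_twoForests_eq_sum_spanningTrees {G : SimpleGraph V} {M : Type*} [AddCommMonoid M]
    {i k : V} (hik : G.Adj i k) (φ : SimpleGraph V → M) :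
    ∑ F ∈ twoForests G with ¬ F.Reachable i k, φ F =
      ∑ T ∈ spanningTrees G with T.Adj i k, φ (T.deleteEdges {s(i, k)}) := by
  refine sum_bij' (fun F _ => F ⊔ edge i k) (fun T _ => T.deleteEdges {s(i, k)}) ?_ ?_ ?_ ?_ ?_
  · intro F hF
    simp only [mem_filter, mem_twoForests, mem_spanningTrees] at hF ⊢
    refine ⟨⟨sup_le hF.1.1 ?_, isTree_sup_edge hF.1.2.1 hF.1.2.2 hF.2⟩, ?_⟩
    · rw [edge_le_iff]
      exact Or.inr hik
    · exact Or.inr (by simp [edge_adj, hik.ne])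
  · intro T hT
    simp only [mem_filter, mem_twoForests, mem_spanningTrees] at hT ⊢
    have hle : T.deleteEdges {s(i, k)} ≤ T := deleteEdges_le _
    have hr := not_reachable_deleteEdges hT.1.2 hT.2
    exact ⟨⟨hle.trans hT.1.1, hT.1.2.isAcyclic.anti hle,
      card_connectedComponent_eq_two hr (reachable_or_deleteEdges hT.1.2 i k)⟩, hr⟩
  · intro F hF
    exact deleteEdges_sup_edge fun h => (mem_filter.1 hF).2 h.reachable
  · intro T hT
    exact sup_edge_deleteEdges (mem_filter.1 hT).2
  · intro F hF
    rw [deleteEdges_sup_edge fun h => (mem_filter.1 hF).2 h.reachable]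

open Classical in
lemma sum_adj_reachable_deleteEdges {T : SimpleGraph V} (hT : T.IsTree) (i v : V) :
    (∑ k with T.Adj i k, if (T.deleteEdges {s(i, k)}).Reachable k v then (1 : ℤ) else 0) =
      if v = i then 0 else 1 := by
  rw [← sum_filter, filter_filter, sum_const, nsmul_one]
  split_ifs with h
  · subst h
    rw [filter_eq_empty_iff.2]
    · simp
    · rintro k - ⟨hk, hr⟩
      exact not_reachable_deleteEdges hT hk hr.symm
  · obtain ⟨k, hk, hu⟩ := existsUnique_adj_reachable_deleteEdges hT h
    have : ({k | T.Adj i k ∧ (T.deleteEdges {s(i, k)}).Reachable k v} : Finset V) = {k} := by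
      ext x
      simp only [mem_filter, mem_univ, true_and, mem_singleton]
      exact ⟨hu x, fun h => h ▸ hk⟩
    rw [this]
    simp

/-! ### The Poisson equation for forest weights -/

/-- The total weight of the tree containing `i`, summed over the 2-forests separating `i`
from `j`. -/
def forestWeight (G : SimpleGraph V) (w : V → ℤ) (j i : V) : ℤ :=
  ∑ F ∈ separatingForests G i j, ∑ v ∈ treeOf F i, w v

open Classical in
lemma forestWeight_eq (G : SimpleGraph V) (w : V → ℤ) (j i : V) :
    forestWeight G w j i = ∑ F ∈ twoForests G, ∑ v,
      if ¬ F.Reachable i j ∧ F.Reachable i v then w v else 0 := by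
  rw [forestWeight, separatingForests, sum_filter]
  refine sum_congr rfl fun F _ => ?_
  rw [treeOf, sum_filter]
  split_ifs with h <;> simp [h]

open Classical in
-- When `i` and `k` are separated, being on the side of `i` is the negation of being on the side of
-- `k`, so the products of indicators cancel. The linear remainder can be summed over `k` one node
-- at a time.
lemma forestWeight_sub (G : SimpleGraph V) (w : V → ℤ) (j i k : V) :
    forestWeight G w j i - forestWeight G w j k =
      ∑ F ∈ twoForests G with ¬ F.Reachable i k, ∑ v, w v *
        ((if F.Reachable k j then 1 else 0) - if F.Reachable k v then 1 else 0) := by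
  rw [forestWeight_eq, forestWeight_eq, ← sum_sub_distrib, sum_filter]
  refine sum_congr rfl fun F hF => ?_
  rw [← sum_sub_distrib]
  by_cases h : ¬ F.Reachable i k
  · rw [if_pos h]
    have hiff := reachable_iff_not_reachable (mem_twoForests.1 hF).2.2 h
    refine sum_congr rfl fun v _ => ?_
    simp only [hiff j, hiff v]
    split_ifs <;> simp_all
  · have hiff : ∀ x, F.Reachable i x ↔ F.Reachable k x := fun x =>
      ⟨(not_not.1 h).symm.trans, (not_not.1 h).trans⟩
    simp [hiff]

/-- `forestWeight` solves the Poisson equation of the graph Laplacian away from `j`. -/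
lemma sum_forestWeight_sub (G : SimpleGraph V) [DecidableRel G.Adj] (w : V → ℤ) {i j : V}
    (hij : i ≠ j) :
    ∑ k ∈ G.neighborFinset i, (forestWeight G w j i - forestWeight G w j k) =
      #(spanningTrees G) * w i := by
  classical
  set φ : V → SimpleGraph V → ℤ := fun k F => ∑ v, w v *
    ((if F.Reachable k j then 1 else 0) - if F.Reachable k v then 1 else 0) with hφ
  have h1 : ∀ k ∈ G.neighborFinset i, forestWeight G w j i - forestWeight G w j k =
      ∑ T ∈ spanningTrees G, if T.Adj i k then φ k (T.deleteEdges {s(i, k)}) else 0 :=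
    fun k hk => by
      rw [forestWeight_sub, ← sum_filter]
      exact sum_twoForests_eq_sum_spanningTrees ((mem_neighborFinset ..).1 hk) (φ k)
  rw [sum_congr rfl h1, sum_comm, ← nsmul_eq_mul, ← sum_const]
  refine sum_congr rfl fun T hT => ?_
  rw [mem_spanningTrees] at hT
  have h2 : ∑ k ∈ G.neighborFinset i, (if T.Adj i k then φ k (T.deleteEdges {s(i, k)}) else 0) =
      ∑ k with T.Adj i k, φ k (T.deleteEdges {s(i, k)}) := by
    rw [sum_filter]
    refine sum_subset (subset_univ _) fun k _ hk => if_neg fun h => hk ?_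
    exact (mem_neighborFinset ..).2 (hT.1 h)
  rw [h2, hφ, sum_comm]
  have h3 : ∀ v, (∑ k with T.Adj i k,
      if (T.deleteEdges {s(i, k)}).Reachable k v then (1 : ℤ) else 0) = if v = i then 0 else 1 :=
    fun v => by convert sum_adj_reachable_deleteEdges hT.2 i v
  simp only [← mul_sum, sum_sub_distrib]
  trans ∑ v, w v * ((if j = i then 0 else 1) - if v = i then 0 else 1)
  · refine sum_congr rfl fun v _ => ?_
    rw [← h3 j, ← h3 v]
    congr!
  · rw [sum_eq_single i] <;> simp +contextual [hij.symm]

/-! ### Independence of the root -/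

/-- The forest sum does not depend on the root. -/
lemma sum_degree_mul_forest (G : SimpleGraph V) [DecidableRel G.Adj] (r : V) :
    ∑ u ∈ univ.erase r, G.degree u * ∑ F ∈ separatingForests G r u, vol G (treeOf F r) =
      ∑ F ∈ twoForests G, vol G (treeOf F r) * vol G (treeOf F r)ᶜ := by
  classical
  have h1 : ∀ u, G.degree u * ∑ F ∈ separatingForests G r u, vol G (treeOf F r) =
      ∑ F ∈ twoForests G, if F.Reachable r u then 0 else vol G (treeOf F r) * G.degree u := by
    intro u
    rw [separatingForests, sum_filter, mul_sum]
    refine sum_congr rfl fun F _ => ?_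
    split_ifs <;> simp_all [mul_comm]
  simp only [h1]
  rw [sum_erase _ (by simp), sum_comm]
  refine sum_congr rfl fun F _ => ?_
  rw [vol, vol, mul_sum, treeOf, compl_filter, sum_filter, sum_filter]
  simp only [ite_not]

lemma sum_degree_mul_forest_eq (G : SimpleGraph V) [DecidableRel G.Adj]
    (r s : V) :
    ∑ u ∈ univ.erase r, G.degree u * ∑ F ∈ separatingForests G r u, vol G (treeOf F r) =
      ∑ u ∈ univ.erase s, G.degree u * ∑ F ∈ separatingForests G s u, vol G (treeOf F s) := by
  rw [sum_degree_mul_forest, sum_degree_mul_forest]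
  refine sum_congr rfl fun F hF => ?_
  by_cases h : F.Reachable r s
  · have : treeOf F r = treeOf F s := by
      ext x
      simp only [treeOf, mem_filter, mem_univ, true_and]
      exact ⟨h.symm.trans, h.trans⟩
    rw [this]
  · have : treeOf F r = (treeOf F s)ᶜ := by
      ext x
      simpa [treeOf] using reachable_iff_not_reachable (mem_twoForests.1 hF).2.2 h x
    rw [this, compl_compl, mul_comm]

end Combinatorics

end KemenyForest

end

noncomputable section

namespace KemenyForest

open SimpleGraph Finset MeasureTheory ProbabilityTheory

/-! ### Hitting times of the random walk -/

section Walk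

/-- The tail-sum identity τ = Σₙ 1[τ > n], valid also for τ = ∞. -/
lemma firstVisit_eq_tsum {V : Type*} [DecidableEq V] (j : V) (x : ℕ → V) :
    firstVisit j x = ∑' n, if ∀ k ≤ n, x k ≠ j then 1 else 0 := by
  by_cases h : ∃ n, x n = j
  · have hiff : ∀ n, (∀ k ≤ n, x k ≠ j) ↔ n ∈ range (Nat.find h) := fun n => by
      rw [mem_range, Nat.lt_find_iff]
    simp_rw [hiff]
    rw [tsum_eq_sum (s := range (Nat.find h)) fun n hn => if_neg hn, sum_ite_mem, inter_self]
    simp only [sum_const, card_range, nsmul_one]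
    refine le_antisymm (iInf₂_le (Nat.find h) (Nat.find_spec h)) (le_iInf₂ fun n hn => ?_)
    exact_mod_cast Nat.find_min' h hn
  · push Not at h
    simp [firstVisit, h]

variable {V : Type*} [Fintype V] (G : SimpleGraph V) [DecidableRel G.Adj]

lemma lintegral_step [MeasurableSpace V] [DiscreteMeasurableSpace V] (v : V) (g : V → ℝ≥0∞) :
    ∫⁻ w, g w ∂(step G v).toMeasure = ∑ w, step G v w * g w := by
  rw [lintegral_fintype]
  refine sum_congr rfl fun w _ => ?_
  rw [PMF.toMeasure_apply_singleton _ _ (measurableSet_singleton w), mul_comm]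

lemma step_apply {v : V} (hv : (G.neighborFinset v).Nonempty) (w : V) :
    step G v w = if G.Adj v w then (G.degree v : ℝ≥0∞)⁻¹ else 0 := by
  rw [step, dif_pos hv, PMF.uniformOfFinset_apply]
  simp

lemma first_step_iff {v : V} (hv : (G.neighborFinset v).Nonempty) (f : V → ℝ≥0∞) :
    f v = 1 + ∑ w, step G v w * f w ↔
      G.degree v * f v = G.degree v + ∑ w ∈ G.neighborFinset v, f w := by
  have hd : (G.degree v : ℝ≥0∞) ≠ 0 := by
    rw [← card_neighborFinset_eq_degree]
    exact_mod_cast hv.card_pos.ne'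
  have hd' : (G.degree v : ℝ≥0∞) ≠ ⊤ := ENNReal.natCast_ne_top _
  have h : ∑ w, step G v w * f w = (G.degree v : ℝ≥0∞)⁻¹ * ∑ w ∈ G.neighborFinset v, f w := by
    simp_rw [step_apply G hv, ite_mul, zero_mul]
    rw [← sum_filter, ← neighborFinset_eq_filter, mul_sum]
  rw [← ENNReal.mul_right_inj hd hd', h, mul_add, mul_one, ← mul_assoc,
    ENNReal.mul_inv_cancel hd hd', one_mul]

/-- The Markov property of the walk at time `n`. -/
lemma lintegral_walkLaw_succ [MeasurableSpace V] [DiscreteMeasurableSpace V] (i : V) (n : ℕ)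
    (φ : ((_ : Iic n) → V) → ℝ≥0∞) (g : V → ℝ≥0∞) :
    ∫⁻ x, φ (Preorder.frestrictLe n x) * g (x (n + 1)) ∂walkLaw G i =
      ∫⁻ x, φ (Preorder.frestrictLe n x) * ∑ w, step G (x n) w * g w ∂walkLaw G i := by
  have hφ : Measurable φ := .of_discrete
  have hg : Measurable g := .of_discrete
  -- The joint law of the history up to `n` and the next position is the history's law composed with
  -- the kernel.
  have key := Kernel.partialTraj_compProd_eq_map_traj (κ := fun n => walkKernel G n)
    (X := fun _ => V) (Nat.zero_le n) (x₀ := fun _ => i)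
  have hf : Measurable fun p : ((_ : Iic n) → V) × V => φ p.1 * g p.2 :=
    (hφ.comp measurable_fst).mul (hg.comp measurable_snd)
  have h1 := congrArg (fun μ => ∫⁻ p, φ p.1 * g p.2 ∂μ) key
  rw [lintegral_map hf (by fun_prop), Measure.lintegral_compProd hf,
    ← Kernel.traj_map_frestrictLe_apply, lintegral_map .of_discrete (by fun_prop)] at h1
  refine h1.symm.trans (lintegral_congr fun x => ?_)
  refine (lintegral_const_mul (φ (Preorder.frestrictLe n x)) hg).trans (congrArg _ ?_)
  exact lintegral_step G _ g

variable [DecidableEq V]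

/-- The transition operator of the walk killed at `j`. -/
def killedStep (j : V) (g : V → ℝ≥0∞) (v : V) : ℝ≥0∞ :=
  ∑ w, step G v w * if w = j then 0 else g w

/-- Induction with `g` free: the Markov property absorbs the last step into `g`. `killedStep` kills
only on arrival, so a start at `j` is treated apart. -/
lemma lintegral_avoid [MeasurableSpace V] [DiscreteMeasurableSpace V] (i j : V) (n : ℕ)
    (g : V → ℝ≥0∞) :
    ∫⁻ x, (if ∀ k ≤ n, x k ≠ j then 1 else 0) * g (x n) ∂walkLaw G i =
      if i = j then 0 else (killedStep G j)^[n] g i := by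
  have hm : ∀ (n : ℕ) (g : V → ℝ≥0∞),
      Measurable fun x : ℕ → V => g (x n) := fun n g =>
    (Measurable.of_discrete (f := g)).comp (measurable_pi_apply n)
  induction n generalizing g with
  | zero =>
    have h0 : ∀ x : ℕ → V, (∀ k ≤ 0, x k ≠ j) ↔ x 0 ≠ j := by simp
    simp only [h0]
    rw [walkLaw, Kernel.lintegral_traj _ (hm 0 fun v => (if v ≠ j then 1 else 0) * g v)]
    have : IsProbabilityMeasure (walkLaw G i) := by
      unfold walkLaw
      infer_instance
    simp [Function.updateFinset]
  | succ n ih =>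
    have h1 : ∀ x : ℕ → V, (if ∀ k ≤ n + 1, x k ≠ j then (1 : ℝ≥0∞) else 0) * g (x (n + 1)) =
        (fun y : (_ : Iic n) → V => if ∀ k, y k ≠ j then (1 : ℝ≥0∞) else 0)
          (Preorder.frestrictLe n x) * (fun w => if w = j then 0 else g w) (x (n + 1)) := by
      intro x
      have : (∀ k ≤ n + 1, x k ≠ j) ↔ (∀ k ≤ n, x k ≠ j) ∧ x (n + 1) ≠ j := by
        constructor
        · exact fun h => ⟨fun k hk => h k (by omega), h _ le_rfl⟩
        · rintro ⟨h, h'⟩ k hk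
          rcases Nat.le_succ_iff.1 hk with hk | rfl
          exacts [h k hk, h']
      by_cases hx : x (n + 1) = j <;> simp [this, hx]
    refine (lintegral_congr h1).trans ((lintegral_walkLaw_succ G i n
      (fun y => if ∀ k, y k ≠ j then 1 else 0) (fun w => if w = j then 0 else g w)).trans ?_)
    rw [Function.iterate_succ_apply, ← ih]
    refine lintegral_congr fun x => ?_
    simp [killedStep]

lemma hittingTime_eq_tsum (i j : V) :
    hittingTime G i j = if i = j then 0 else ∑' n, (killedStep G j)^[n] 1 i := by
  let : MeasurableSpace V := ⊤
  have : DiscreteMeasurableSpace V := ⟨fun _ => trivial⟩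
  have hm : ∀ n : ℕ, Measurable fun x : ℕ → V =>
      if ∀ k ≤ n, x k ≠ j then (1 : ℝ≥0∞) else 0 := fun n => by
    have : (fun x : ℕ → V => if ∀ k ≤ n, x k ≠ j then (1 : ℝ≥0∞) else 0) =
        (fun y : (_ : Iic n) → V => if ∀ k, y k ≠ j then (1 : ℝ≥0∞) else 0) ∘
          Preorder.frestrictLe n := by
      ext x
      rw [Function.comp_apply]
      congr 1
      simp
    rw [this]
    exact Measurable.of_discrete.comp (by fun_prop)
  have h1 : ∀ n, ∫⁻ x, (if ∀ k ≤ n, x k ≠ j then 1 else 0) ∂walkLaw G i =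
      if i = j then 0 else (killedStep G j)^[n] 1 i := fun n => by
    rw [← lintegral_avoid]
    simp
  change ∫⁻ x, firstVisit j x ∂walkLaw G i = _
  simp_rw [firstVisit_eq_tsum]
  rw [lintegral_tsum fun n => (hm n).aemeasurable]
  simp_rw [h1]
  split_ifs <;> simp

lemma hittingTime_self (j : V) : hittingTime G j j = 0 := by
  rw [hittingTime_eq_tsum, if_pos rfl]

/-- First-step analysis. -/
lemma hittingTime_eq_one_add {i j : V} (hij : i ≠ j) :
    hittingTime G i j = 1 + ∑ w, step G i w * hittingTime G w j := by
  rw [hittingTime_eq_tsum, if_neg hij, tsum_eq_zero_add' ENNReal.summable]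
  simp_rw [Function.iterate_succ_apply', killedStep, hittingTime_eq_tsum]
  rw [Summable.tsum_finsetSum fun _ _ => ENNReal.summable]
  simp_rw [ENNReal.tsum_mul_left]
  congr 1
  refine sum_congr rfl fun w _ => ?_
  split_ifs <;> simp

/-- The hitting times form the least solution of the first-step equations. -/
lemma hittingTime_le {j : V} {f : V → ℝ≥0∞}
    (hf : ∀ i, i ≠ j → f i = 1 + ∑ w, step G i w * f w) (i : V) : hittingTime G i j ≤ f i := by
  rw [hittingTime_eq_tsum]
  split_ifs with hij
  · exact zero_le
  -- Each use of the first-step equation adds one term to the partial sum; the value `f j` needs no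
  -- hypothesis because arrivals at `j` are killed.
  have key : ∀ n i, i ≠ j → ∑ k ∈ range n, (killedStep G j)^[k] 1 i ≤ f i := by
    intro n
    induction n with
    | zero => simp
    | succ n ih =>
      intro i hi
      rw [sum_range_succ', hf i hi, add_comm]
      simp_rw [Function.iterate_succ_apply', killedStep]
      rw [sum_comm]
      simp_rw [← mul_sum]
      refine add_le_add (by simp) (sum_le_sum fun w _ => mul_le_mul_right ?_ _)
      by_cases hw : w = j
      · simp [hw]
      · simpa [hw] using ih w hw
  exact ENNReal.tsum_le_of_sum_range_le fun n => key n i hij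

/-- Uniqueness for the Poisson equation of the Laplacian of a connected graph. -/
lemma eq_of_sum_sub_eq (hG : G.Connected) {f g : V → ℝ} {j : V} (hj : f j = g j)
    (h : ∀ i, i ≠ j → ∑ k ∈ G.neighborFinset i, (f i - f k) =
      ∑ k ∈ G.neighborFinset i, (g i - g k)) : f = g := by
  -- At `j` the first factor vanishes, elsewhere the second. So the Dirichlet energy of `f - g` is
  -- zero and `f - g` is constant.
  have hL : ∀ i, (f - g) i * (G.lapMatrix ℝ).mulVec (f - g) i = 0 := fun i => by
    by_cases hi : i = j
    · simp [hi, hj]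
    · have := h i hi
      rw [lapMatrix_mulVec_apply]
      simp only [sum_sub_distrib, sum_const, card_neighborFinset_eq_degree, nsmul_eq_mul] at this
      simp only [Pi.sub_apply, sum_sub_distrib]
      rw [mul_eq_zero]
      right
      linarith
  have h0 := (lapMatrix_toLinearMap₂'_apply'_eq_zero_iff_forall_reachable G (f - g)).1 (by
    rw [Matrix.toLinearMap₂'_apply']
    exact sum_eq_zero fun i _ => hL i)
  ext i
  have := h0 i j (hG.preconnected i j)
  simp only [Pi.sub_apply] at this
  linarith

/-- The forest formula for hitting times. -/
theorem hittingTime_eq_forest [Nontrivial V] (hG : G.Connected) (i j : V) :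
    hittingTime G i j =
      ((∑ F ∈ separatingForests G i j, vol G (treeOf F i) : ℕ) : ℝ≥0∞) /
        #(spanningTrees G) := by
  set N : V → ℕ := fun x => ∑ F ∈ separatingForests G x j, vol G (treeOf F x) with hN
  have hΓ : #(spanningTrees G) ≠ 0 := by
    obtain ⟨T, hT⟩ := hG.exists_isTree_le
    exact (card_pos.2 ⟨T, mem_spanningTrees.2 hT⟩).ne'
  have hne : ∀ v, (G.neighborFinset v).Nonempty := fun v => by
    obtain ⟨w, hw⟩ := hG.preconnected.exists_adj_of_nontrivial v
    exact ⟨w, (mem_neighborFinset ..).2 hw⟩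
  have hNw : ∀ x, (N x : ℤ) = forestWeight G (fun v => G.degree v) j x := fun x => by
    simp [hN, forestWeight, vol]
  have hNj : N j = 0 := by simp [hN, separatingForests]
  -- Written without subtraction, so that it transfers to `ℝ≥0∞`.
  have hpois : ∀ v, v ≠ j → G.degree v * N v =
      #(spanningTrees G) * G.degree v + ∑ k ∈ G.neighborFinset v, N k := fun v hv => by
    have := sum_forestWeight_sub G (fun v => (G.degree v : ℤ)) hv
    simp only [← hNw, sum_sub_distrib, sum_const, card_neighborFinset_eq_degree,
      nsmul_eq_mul] at this
    zify
    linarith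
  set f : V → ℝ≥0∞ := fun x => (N x : ℝ≥0∞) / #(spanningTrees G) with hf
  have hΓ0 : (#(spanningTrees G) : ℝ≥0∞) ≠ 0 := by exact_mod_cast hΓ
  have hΓt : (#(spanningTrees G) : ℝ≥0∞) ≠ ⊤ := ENNReal.natCast_ne_top _
  have hfeq : ∀ v, v ≠ j → f v = 1 + ∑ w, step G v w * f w := fun v hv => by
    rw [first_step_iff G (hne v)]
    have := congrArg (Nat.cast : ℕ → ℝ≥0∞) (hpois v hv)
    push_cast at this
    simp only [hf, div_eq_mul_inv]
    rw [← mul_assoc, this, add_mul, sum_mul, mul_right_comm, ENNReal.mul_inv_cancel hΓ0 hΓt,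
      one_mul]
  have hft : ∀ v, f v ≠ ⊤ := fun v => ENNReal.div_ne_top (ENNReal.natCast_ne_top _) hΓ0
  -- Minimality against the finite solution `f` gives finiteness, which permits the passage to real
  -- differences.
  have hht : ∀ v, hittingTime G v j ≠ ⊤ := fun v =>
    ne_top_of_le_ne_top (hft v) (hittingTime_le G hfeq v)
  have toR : ∀ g : V → ℝ≥0∞, (∀ v, g v ≠ ⊤) → ∀ v, g v = 1 + ∑ w, step G v w * g w →
      ∑ k ∈ G.neighborFinset v, ((g v).toReal - (g k).toReal) = G.degree v := by
    intro g hg v h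
    rw [first_step_iff G (hne v)] at h
    have := congrArg ENNReal.toReal h
    rw [ENNReal.toReal_add (by simp) (by simp [ENNReal.sum_eq_top, hg]), ENNReal.toReal_mul,
      ENNReal.toReal_sum fun w _ => hg w] at this
    simp only [ENNReal.toReal_natCast] at this
    simp only [sum_sub_distrib, sum_const, card_neighborFinset_eq_degree, nsmul_eq_mul]
    linarith
  have := eq_of_sum_sub_eq G hG (f := fun v => (hittingTime G v j).toReal)
    (g := fun v => (f v).toReal) (j := j) (by simp [hittingTime_self, hf, hNj]) fun v hv => by
      rw [toR _ hft v (hfeq v hv), toR _ hht v (hittingTime_eq_one_add G hv)]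
  exact (ENNReal.toReal_eq_toReal_iff' (hht i) (hft i)).1 (congrFun this i)

end Walk

end KemenyForest

end

/-! ### The Kemeny constant -/

open KemenyForest in
theorem mainTheorem1 {V : Type*} [Fintype V] [DecidableEq V] [Nontrivial V]
    (G : SimpleGraph V) [DecidableRel G.Adj] (hG : G.Connected) (r s : V) :
    KemenyForest.kemenyConstant G s =
      1 / (2 * (G.edgeFinset.card : ENNReal) * ((KemenyForest.spanningTrees G).card : ENNReal)) *
        ∑ u ∈ Finset.univ.erase r, (G.degree u : ENNReal) *
          ∑ F ∈ KemenyForest.separatingForests G r u,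
            (KemenyForest.vol G (KemenyForest.treeOf F r) : ENNReal) := by
  have h := congrArg (Nat.cast : ℕ → ENNReal) (sum_degree_mul_forest_eq G r s)
  push_cast at h
  -- With the root moved to `s`, the two sums agree term by term.
  rw [h, kemenyConstant, ← Finset.sum_erase _ (a := s) (by rw [hittingTime_self, mul_zero]),
    Finset.mul_sum]
  refine Finset.sum_congr rfl fun u _ => ?_
  rw [hittingTime_eq_forest G hG, stationary, one_div, ENNReal.mul_inv 
    (Or.inr (ENNReal.natCast_ne_top _))
    (Or.inl (ENNReal.mul_ne_top (by simp) (ENNReal.natCast_ne_top _)))]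
  simp only [div_eq_mul_inv]
  push_cast
  ring
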